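/- \textbf{Theorem (lower bound for labeling heuristics on grids).} \emph{Definitions.} An $n$-vertex weighted grid graph (with obstacles) is a connected graph whose vertices are $n$ distinct cells of the square grid $\mathbb Z^2$ and whose edges join some of the pairs of cells sharing a side (an obstacle is a missing cell or a missing edge), with positive integer weights that are either (a) placed on the undirected edges, $w(u,v)=w(v,u)$, or (b) placed on the cells, a step from $u$ to an adjacent $v$ then costing $w(u,v)=c(v)$. Its total weight is the sum of $w(u,v)$ over ordered pairs of adjacent vertices. A labeling heuristic of length $L$ over the alphabet $\{0,\dots,C\}$ consists of a map $f$, which assigns a label $f_G(v)\in\{0,\dots,C\}^L$ to each vertex $v$ of each $n$-vertex weighted grid graph $G$, and one map $g:\{0,\dots,C\}^L\times\{0,\dots,C\}^L\to\{0,\dots,C\}$ that serves all these graphs; $f$ and $g$ are arbitrary functions that may depend on $n$. On $G$ it yields $h_G(s,t)=g(f_G(s),f_G(t))$. It is consistent on $G$ if $h_G(t,t)=0$ and $w(u,v)+h_G(v,t)-h_G(u,t)\ge 0$ for every vertex $t$ and every edge $(u,v)$, in both directions. A* from $s$ to $t$ starts with no vertex scanned, $d(s)=0$ and $d(v)=\infty$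 for $v\ne s$; until $t$ is scanned it repeatedly scans an unscanned vertex $u$ that minimizes $d(u)+h_G(u,t)$, with ties broken in any way, and sets $d(v)=\min(d(v),d(u)+w(u,v))$ for all neighbours $v$ of $u$. \emph{Statement.} Let $0\le\alpha<\tfrac12$. There is a constant $c>0$, depending only on $\alpha$, such that the following holds in each of the weight models (a) and (b). Let $L(n)=o(n^{\alpha})$, and let $C(n)$ be polynomially bounded in $n$ with $C(n)\ge n^6$ for all large $n$. Then for all sufficiently large $n$ and every labeling heuristic of length $L(n)$ over $\{0,\dots,C(n)\}$ that is consistent on all $n$-vertex weighted grid graphs of total weight at most $C(n)$, there is an $n$-vertex weighted grid graph $G$ of total weight at most $C(n)$ on which, however ties are broken in the individual queries, the number of vertices scanned by A* from $s$ to $t$, averaged over all $n^2$ ordered pairs $(s,t)$ of vertices, is at least $c\,n^{1-\alpha}$. -/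

import Mathlib

open Filter Asymptotics

/-- A connected weighted `n`-vertex grid graph with obstacles: distinct cells of the square grid
`ℤ × ℤ`, where two cells can be joined only if they share a side. An obstacle is a missing cell or
a missing edge between neighbouring cells. `w u v` is the positive integer cost of the step from
`u` to `v` along an edge; its value off the edges is never used. -/
structure WeightedGrid (n : ℕ) where
  cell : Fin n → ℤ × ℤ
  cell_injective : Function.Injective cell
  graph : SimpleGraph (Fin n)
  adj_cell : ∀ u v, graph.Adj u v →
    |(cell u).1 - (cell v).1| + |(cell u).2 - (cell v).2| = 1
  connected : graph.Connected
  w : Fin n → Fin n → ℕ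
  w_pos : ∀ u v, graph.Adj u v → 0 < w u v

/-- The two ways of putting weights on a grid graph: on the undirected edges, or on the cells. -/
inductive WeightModel where
  | onEdges
  | onCells

namespace WeightedGrid

variable {n : ℕ}

/-- The step costs of `G` come from weights of the given kind: from weights of undirected edges, or
from weights `c` of the cells, a step from `u` to `v` costing `c v` (so that the length of a path is
the sum of the weights of the cells it enters). -/
def OfModel (G : WeightedGrid n) : WeightModel → Prop
  | .onEdges => ∀ u v, G.graph.Adj u v → G.w u v = G.w v u
  | .onCells => ∃ c : Fin n → ℕ, ∀ u v, G.graph.Adj u v → G.w u v = c v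

open Classical in
/-- The sum of `w u v` over all ordered pairs of adjacent vertices. -/
noncomputable def totalWeight (G : WeightedGrid n) : ℕ :=
  ∑ u, ∑ v, if G.graph.Adj u v then G.w u v else 0

/-- The weighted grid graphs on `n` vertices with weights of the given kind and total weight at most
`C`. -/
def instances (M : WeightModel) (n C : ℕ) : Set (WeightedGrid n) :=
  {G | G.OfModel M ∧ G.totalWeight ≤ C}

/-- `h s t` is a consistent estimate of the distance from `s` to `t`. -/
def IsConsistent (G : WeightedGrid n) (h : Fin n → Fin n → ℕ) : Prop :=
  ∀ t, h t t = 0 ∧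
    ∀ u v, G.graph.Adj u v → (0 : ℤ) ≤ (G.w u v : ℤ) + (h v t : ℤ) - (h u t : ℤ)

open Classical in
/-- The states `(S, d)` that A* from `s` to `t` with heuristic `h` can reach under some way of
breaking ties; `S` is the set of scanned vertices and `d` are the tentative distances. As long as
`t` has not been scanned, a vertex `u` outside `S` that minimizes `d u + h u t` is scanned and its
edges are relaxed. The first scanned vertex is always `s`. -/
inductive AStarState (G : WeightedGrid n) (h : Fin n → Fin n → ℕ) (s t : Fin n) :
    Finset (Fin n) → (Fin n → ℕ∞) → Prop
  | init : AStarState G h s t ∅ (fun v => if v = s then 0 else ⊤)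
  | scan {S : Finset (Fin n)} {d : Fin n → ℕ∞} {u : Fin n} :
      AStarState G h s t S d → t ∉ S → u ∉ S →
      (∀ v, v ∉ S → d u + (h u t : ℕ∞) ≤ d v + (h v t : ℕ∞)) →
      AStarState G h s t (insert u S)
        (fun v => if G.graph.Adj u v then min (d v) (d u + (G.w u v : ℕ∞)) else d v)

/-- `S` is the set of vertices scanned by some complete run of A* from `s` to `t`. -/
def IsScannedSet (G : WeightedGrid n) (h : Fin n → Fin n → ℕ) (s t : Fin n)
    (S : Finset (Fin n)) : Prop :=
  t ∈ S ∧ ∃ d, G.AStarState h s t S d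

end WeightedGrid

/-- A labeling scheme with label length `L` over the alphabet `{0, …, C}`, for weighted grid graphs
on `n` vertices: the label of a vertex may depend arbitrarily on the whole graph, while the decoder
sees only two labels. -/
structure LabelingScheme (n L C : ℕ) where
  f : WeightedGrid n → Fin n → (Fin L → Fin (C + 1))
  g : (Fin L → Fin (C + 1)) → (Fin L → Fin (C + 1)) → Fin (C + 1)

/-- The labeling heuristic that the scheme induces on the graph `G`. -/
def LabelingScheme.heuristic {n L C : ℕ} (H : LabelingScheme n L C) (G : WeightedGrid n)
    (s t : Fin n) : ℕ :=
  (H.g (H.f G s) (H.f G t) : ℕ)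

/-! The proof is a counting argument. Take a `k × k` square of expensive cells, with an arbitrary
matrix of entries below `n` written into the low-order part of the weights, and attach a cheap trail
of `T` cells to the start of each row and to the end of each column. Inside the square the weights
fall with the column index and rise with the row index, so a shortest way from the trail of row `y`
to the trail of column `j` follows row `y` and then column `j` (`potential_feasible`). Among the
matrix entries, its length involves only those at `(i, y)` with `i ≤ j` and at `(j, y')` with `y' >
y`. Hence the `k²` distances determine the matrix entry by entry. An error of `4 * T` in each
distance does no harm, because changing one entry moves the distance by at least `4 * n`
(`eq_of_potential_near`, `decode`).

If the heuristic is more than `4 * T` below the distance, A* scans the whole trail of the source,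
whose cells are so cheap that `d + h` stays below the distance (`IsScannedSet.mem_of_path`,
`le_card_of_gap`). If few vertices were scanned on every grid, then for each matrix some positions
`p`, `q` in the trails would have at most `k² / 2` such bad pairs `(j, y)`. The matrix could then be
recovered from `p`, `q`, the labels of only `2 * k` vertices, the bad set and the entries there. For
`k` of order `n ^ α`, which dominates the label length, there are fewer than `n ^ (k * k)` such
descriptions (`labels_too_short`). So some grid has an average of at least `T³k² / (2n²)`. Since `k
* T` is of order `n`, this is of order `T`, that is, `n ^ (1 - α)`. -/

namespace WeightedGrid

/-! ### A* with a consistent heuristic. -/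

open Classical in
/-- Invariants of A* with a consistent heuristic: the edges that leave scanned vertices are relaxed,
scanned vertices come before unscanned ones in the order of `d + h`, and tentative distances are
bounded below by any feasible potential. -/
theorem AStarState.invariant {n : ℕ} {G : WeightedGrid n} {h : Fin n → Fin n → ℕ} {s t : Fin n}
    (hc : G.IsConsistent h) {Ψ : Fin n → ℤ}
    (hΨ : ∀ u v, G.graph.Adj u v → Ψ v ≤ Ψ u + G.w u v)
    {S : Finset (Fin n)} {d : Fin n → ℕ∞} (hS : G.AStarState h s t S d) :
    (∀ u ∈ S, ∀ v, G.graph.Adj u v → d v ≤ d u + G.w u v) ∧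
    (∀ x ∈ S, ∀ u, u ∉ S → d x + h x t ≤ d u + h u t) ∧
    d s = 0 ∧ ∀ v (m : ℕ), d v = m → Ψ v - Ψ s ≤ m := by
  have hc' : ∀ u v, G.graph.Adj u v → (h u t : ℕ∞) ≤ G.w u v + h v t := by
    intro u v huv
    have := (hc t).2 u v huv
    exact_mod_cast (by omega : h u t ≤ G.w u v + h v t)
  induction hS with
  | init =>
    refine ⟨by simp, by simp, by simp, ?_⟩
    intro v m hv
    by_cases hvs : v = s
    · subst hvs; simp
    · simp [hvs] at hv
  | @scan S d u hS htS huS hmin ih =>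
    obtain ⟨hB, hC, hD, hA⟩ := ih
    have hle : ∀ v, (if G.graph.Adj u v then min (d v) (d u + (G.w u v : ℕ∞)) else d v) ≤ d v := by
      intro v; split_ifs
      · exact min_le_left _ _
      · exact le_rfl
    -- Relaxation never improves a scanned vertex. This is where consistency enters, as nonnegative
    -- reduced costs do in Dijkstra's algorithm.
    have hold : ∀ x ∈ insert u S,
        (if G.graph.Adj u x then min (d x) (d u + (G.w u x : ℕ∞)) else d x) = d x := by
      intro x hx
      split_ifs with hux
      · rcases Finset.mem_insert.1 hx with rfl | hx
        · exact absurd hux (G.graph.loopless.irrefl _)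
        · refine min_eq_left ?_
          have h1 := hC x hx u huS
          have h2 : d x + (h x t : ℕ∞) ≤ (d u + G.w u x) + h x t := by
            refine h1.trans ?_
            rw [add_assoc]
            gcongr
            exact hc' u x hux
          exact (ENat.add_le_add_iff_right (ENat.natCast_ne_top _)).1 h2
      · rfl
    refine ⟨?_, ?_, ?_, ?_⟩
    · intro x hx v hxv
      beta_reduce
      rw [hold x hx]
      rcases Finset.mem_insert.1 hx with rfl | hx
      · rw [if_pos hxv]; exact min_le_right _ _
      · exact (hle v).trans (hB x hx v hxv)
    · intro x hx v hv
      beta_reduce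
      rw [hold x hx]
      simp only [Finset.mem_insert, not_or] at hv
      have hxu : d x + (h x t : ℕ∞) ≤ d u + h u t := by
        rcases Finset.mem_insert.1 hx with rfl | hx
        · exact le_rfl
        · exact hC x hx u huS
      refine hxu.trans ?_
      split_ifs with huv
      · rcases min_choice (d v) (d u + (G.w u v : ℕ∞)) with hm | hm <;> rw [hm]
        · exact hmin v hv.2
        · rw [add_assoc]
          gcongr
          exact hc' u v huv
      · exact hmin v hv.2
    · exact le_antisymm ((hle s).trans hD.le) zero_le
    · intro v m hv
      beta_reduce at hv
      split_ifs at hv with huv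
      · rcases min_choice (d v) (d u + (G.w u v : ℕ∞)) with hm | hm
        · exact hA v m (hm ▸ hv)
        · rw [hm] at hv
          have hu : d u ≠ ⊤ := by
            intro hu; rw [hu] at hv; simp at hv
          obtain ⟨l, hl⟩ := ENat.ne_top_iff_exists.1 hu
          have h1 := hA u l hl.symm
          rw [← hl] at hv
          have h2 : l + G.w u v = m := by exact_mod_cast hv
          have h3 := hΨ u v huv
          omega
      · exact hA v m hv

/-- If the heuristic underestimates the distance from `s` to `t` by more than `2 * W * len`, then
A* scans the first `len` vertices of every path from `s` with steps of cost at most `W`. -/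
theorem IsScannedSet.mem_of_path {n : ℕ} {G : WeightedGrid n} {h : Fin n → Fin n → ℕ}
    {s t : Fin n} (hc : G.IsConsistent h) {Ψ : Fin n → ℤ}
    (hΨ : ∀ u v, G.graph.Adj u v → Ψ v ≤ Ψ u + G.w u v)
    {S : Finset (Fin n)} (hS : G.IsScannedSet h s t S) {W len : ℕ} (u : ℕ → Fin n) (hu : u 0 = s)
    (hadj : ∀ i < len, G.graph.Adj (u i) (u (i + 1)))
    (hw : ∀ i < len, G.w (u i) (u (i + 1)) ≤ W)
    (hw' : ∀ i < len, G.w (u (i + 1)) (u i) ≤ W)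
    (hgap : (h s t : ℤ) + 2 * (W * len : ℕ) < Ψ t - Ψ s) :
    ∀ i ≤ len, u i ∈ S := by
  obtain ⟨htS, d, hd⟩ := hS
  obtain ⟨hB, hC, hD, hA⟩ := hd.invariant hc hΨ
  -- If `v` were unscanned, the scanned `t`, with `h t t = 0`, would satisfy `d t ≤ d v + h v t`,
  -- against the lower bound `Ψ t - Ψ s` on `d t`.
  have key : ∀ v (m : ℕ), d v ≤ m → (m + h v t : ℤ) < Ψ t - Ψ s → v ∈ S := by
    intro v m hv hm
    by_contra hvS
    have h1 := hC t htS v hvS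
    rw [(hc t).1] at h1
    have h2 : d t ≤ ((m + h v t : ℕ) : ℕ∞) := by
      push_cast
      refine le_trans (by simpa using h1) ?_
      gcongr
    obtain ⟨l, hl⟩ := ENat.ne_top_iff_exists.1 (ne_top_of_le_ne_top (ENat.natCast_ne_top _) h2)
    have h3 := hA t l hl.symm
    rw [← hl] at h2
    have h4 : l ≤ m + h v t := by exact_mod_cast h2
    omega
  -- A step adds at most `W` to the tentative distance and, by consistency on the reversed edge, at
  -- most `W` to the heuristic; hence the factor 2 in the gap.
  have main : ∀ i ≤ len, u i ∈ S ∧ d (u i) ≤ ((W * i : ℕ) : ℕ∞) ∧ h (u i) t ≤ h s t + W * i := by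
    intro i
    induction i with
    | zero =>
      intro _
      refine ⟨key _ 0 (by simp [hu, hD]) ?_, by simp [hu, hD], by simp [hu]⟩
      rw [hu]
      have : (0 : ℤ) ≤ 2 * (W * len : ℕ) := by positivity
      push_cast
      omega
    | succ i ih =>
      intro hi
      obtain ⟨h1, h2, h3⟩ := ih (by omega)
      have h4 : d (u (i + 1)) ≤ ((W * (i + 1) : ℕ) : ℕ∞) := by
        refine (hB _ h1 _ (hadj i (by omega))).trans ?_
        rw [mul_add_one]
        push_cast
        push_cast at h2
        gcongr
        exact_mod_cast hw i (by omega)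
      have h5 : h (u (i + 1)) t ≤ h s t + W * (i + 1) := by
        have := (hc t).2 _ _ (hadj i (by omega)).symm
        have := hw' i (by omega)
        rw [mul_add_one]
        omega
      refine ⟨key _ _ h4 ?_, h4, h5⟩
      have h6 : W * (i + 1) ≤ W * len := Nat.mul_le_mul_left _ hi
      omega
  exact fun i hi => (main i hi).1

/-- A consistent heuristic plus a potential does not decrease along the edges on which the potential
is tight. -/
theorem IsConsistent.add_le_add {n : ℕ} {G : WeightedGrid n} {h : Fin n → Fin n → ℕ}
    (hc : G.IsConsistent h) {Ψ : Fin n → ℤ} {u v t : Fin n} (huv : G.graph.Adj u v)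
    (htight : Ψ v = Ψ u + G.w u v) : h u t + Ψ u ≤ h v t + Ψ v := by
  have := (hc t).2 u v huv
  omega

end WeightedGrid

/-! ### Cells and weights of the crossing grid. -/

/-- The factor with which the weight of the cell that a step leaves enters the cost of the step. -/
def WeightModel.startFactor : WeightModel → ℕ
  | .onEdges => 1
  | .onCells => 0

theorem WeightModel.startFactor_le_one (M : WeightModel) : M.startFactor ≤ 1 := by
  cases M <;> simp [startFactor]

namespace CrossingGrid

/-- The cells: a `k × k` square, a row of `T` cells to the left of each of its rows, a column of `T`
cells beyond each of its columns, and `r` more cells that continue its first row. -/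
def cells (k T r : ℕ) : Finset (ℕ × ℕ) :=
  (Finset.range (T + k) ×ˢ Finset.range k ∪ Finset.Ico T (T + k) ×ˢ Finset.Ico k (k + T)) ∪
    Finset.Ico (T + k) (T + k + r) ×ˢ {0}

theorem mem_cells {k T r x y : ℕ} : (x, y) ∈ cells k T r ↔
    (x < T + k ∧ y < k) ∨ (T ≤ x ∧ x < T + k ∧ k ≤ y ∧ y < k + T) ∨
      (T + k ≤ x ∧ x < T + k + r ∧ y = 0) := by
  simp only [cells, Finset.mem_union, Finset.mem_product, Finset.mem_range, Finset.mem_Ico,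
    Finset.mem_singleton]
  tauto

theorem card_cells (k T r : ℕ) : (cells k T r).card = (T + k) * k + k * T + r := by
  rw [cells, Finset.card_union_of_disjoint, Finset.card_union_of_disjoint]
  · simp
  · rw [Finset.disjoint_left]
    rintro ⟨x, y⟩ h1 h2
    simp only [Finset.mem_product, Finset.mem_range, Finset.mem_Ico] at h1 h2
    omega
  · rw [Finset.disjoint_left]
    rintro ⟨x, y⟩ h1 h2
    simp only [Finset.mem_union, Finset.mem_product, Finset.mem_range, Finset.mem_Ico] at h1 h2
    omega

/-- Horizontal steps in the first `k` rows and vertical steps from column `T` on. -/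
def Step (k T : ℕ) (a b : ℕ × ℕ) : Prop :=
  (a.2 = b.2 ∧ a.2 < k ∧ (a.1 + 1 = b.1 ∨ b.1 + 1 = a.1)) ∨
    (a.1 = b.1 ∧ T ≤ a.1 ∧ (a.2 + 1 = b.2 ∨ b.2 + 1 = a.2))

/-- The weights of the cells: the cell of the square in column `T + j` and row `y` carries `X j y`. -/
def cost (n k T : ℕ) (X : ℕ → ℕ → ℕ) (x y : ℕ) : ℕ :=
  if T ≤ x ∧ x < T + k ∧ y < k then
    8 * n ^ 3 + 4 * n ^ 2 * (y + (T + k - x)) + 4 * n * X (x - T) y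
  else 1

section cost

variable {n k T : ℕ} {X : ℕ → ℕ → ℕ}

theorem cost_of_square {x y : ℕ} (h : T ≤ x ∧ x < T + k ∧ y < k) : cost n k T X x y =
    8 * n ^ 3 + 4 * n ^ 2 * (y + (T + k - x)) + 4 * n * X (x - T) y := if_pos h

theorem cost_of_not_square {x y : ℕ} (h : ¬(T ≤ x ∧ x < T + k ∧ y < k)) :
    cost n k T X x y = 1 := if_neg h

theorem le_cost {x y : ℕ} (h : T ≤ x ∧ x < T + k ∧ y < k) : 8 * n ^ 3 ≤ cost n k T X x y := by
  rw [cost_of_square h]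
  omega

theorem cost_pos (hn : 0 < n) (x y : ℕ) : 0 < cost n k T X x y := by
  rw [cost]
  split_ifs <;> positivity

variable (hX : ∀ j y, X j y ≤ n)
include hX

theorem cost_le (hn : 0 < n) (hkT : T + k ≤ n) (x y : ℕ) : cost n k T X x y ≤ 20 * n ^ 3 := by
  by_cases h : T ≤ x ∧ x < T + k ∧ y < k
  · rw [cost_of_square h]
    have h1 : 4 * n ^ 2 * (y + (T + k - x)) ≤ 4 * n ^ 2 * (n + n) := by
      gcongr <;> omega
    have h2 : 4 * n * X (x - T) y ≤ 4 * n * n := by gcongr; exact hX _ _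
    nlinarith [Nat.pow_le_pow_right hn (show 2 ≤ 3 by norm_num)]
  · rw [cost_of_not_square h]
    have : 0 < n ^ 3 := by positivity
    omega

/-- The slope `4 * n ^ 2` outweighs the entries, which contribute at most `4 * n * n`. So the
weights are monotone whatever the matrix is, and neighbours differ by at most twice the slope. -/
theorem cost_succ_left {x y : ℕ} (hx : T ≤ x) (hx' : x + 1 < T + k) :
    cost n k T X (x + 1) y ≤ cost n k T X x y ∧
      cost n k T X x y ≤ cost n k T X (x + 1) y + 8 * n ^ 2 := by
  by_cases hy : y < k
  · rw [cost_of_square ⟨hx, by omega, hy⟩, cost_of_square ⟨by omega, hx', hy⟩]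
    have h1 : T + k - x = (T + k - (x + 1)) + 1 := by omega
    rw [h1]
    have h2 : 4 * n * X (x - T) y ≤ 4 * n * n := by gcongr; exact hX _ _
    have h3 : 4 * n * X (x + 1 - T) y ≤ 4 * n * n := by gcongr; exact hX _ _
    constructor <;> nlinarith
  · rw [cost_of_not_square (by omega), cost_of_not_square (by omega)]
    omega

theorem cost_succ_right {x y : ℕ} (hy : y + 1 < k) :
    cost n k T X x y ≤ cost n k T X x (y + 1) ∧
      cost n k T X x (y + 1) ≤ cost n k T X x y + 8 * n ^ 2 := by
  by_cases hx : T ≤ x ∧ x < T + k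
  · rw [cost_of_square ⟨hx.1, hx.2, hy⟩, cost_of_square ⟨hx.1, hx.2, by omega⟩]
    have h2 : 4 * n * X (x - T) y ≤ 4 * n * n := by gcongr; exact hX _ _
    have h3 : 4 * n * X (x - T) (y + 1) ≤ 4 * n * n := by gcongr; exact hX _ _
    constructor <;> nlinarith
  · rw [cost_of_not_square (by omega), cost_of_not_square (by omega)]
    omega

theorem cost_mono_right {x y y' : ℕ} (hy : y ≤ y') (hy' : y' < k) :
    cost n k T X x y ≤ cost n k T X x y' := by
  induction y', hy using Nat.le_induction with
  | base => exact le_rfl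
  | succ y' h ih => exact (ih (by omega)).trans (cost_succ_right hX hy').1

end cost

/-! ### Row-then-column distances and what they reveal. -/

/-- The distances from the row `y₀`: along the row to the column of the cell, then along the
column. -/
def potential (c : ℕ → ℕ → ℕ) (T y₀ x y : ℕ) : ℤ :=
  ∑ i ∈ Finset.range (x + 1), (c i (min y y₀) : ℤ) + ∑ i ∈ Finset.Ioc y₀ y, (c (max x T) i : ℤ)

theorem potential_succ_left {c : ℕ → ℕ → ℕ} {T y₀ x y : ℕ} (hy : y ≤ y₀) :
    potential c T y₀ (x + 1) y = potential c T y₀ x y + c (x + 1) y := by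
  rw [potential, potential, Finset.Ioc_eq_empty (by omega), Finset.sum_range_succ, min_eq_left hy]
  simp

theorem potential_succ_right {c : ℕ → ℕ → ℕ} {T y₀ x y : ℕ} (hx : T ≤ x) (hy : y₀ ≤ y) :
    potential c T y₀ x (y + 1) = potential c T y₀ x y + c x (y + 1) := by
  rw [potential, potential, Finset.sum_Ioc_succ_top hy, max_eq_left hx, min_eq_right hy,
    min_eq_right (by omega)]
  ring

/-- Monotonicity of the weights handles steps to the right beyond row `y₀`. A step to the left
there, or a step towards `y₀` from a smaller row, raises at most `n` terms of a sum by at most `8 *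
n ^ 2` each, and entering a cell of the square, at cost at least `8 * n ^ 3`, pays for it. Off the
row-then-column paths only this inequality matters, so the `min` and `max` in `potential` need not
give true distances. -/
theorem potential_feasible {n k T r y₀ : ℕ} {X : ℕ → ℕ → ℕ} (hX : ∀ j y, X j y ≤ n)
    (hkT : T + k ≤ n) (hy₀ : y₀ < k) {x y x' y' : ℕ} (hm : (x, y) ∈ cells k T r)
    (hm' : (x', y') ∈ cells k T r) (hs : Step k T (x, y) (x', y')) :
    potential (cost n k T X) T y₀ x' y' ≤
      potential (cost n k T X) T y₀ x y + cost n k T X x' y' := by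
  rw [mem_cells] at hm hm'
  have hbig : ∀ l ≤ n, (l : ℤ) * (8 * n ^ 2) ≤ 8 * n ^ 3 := by
    intro l hl
    have : (l : ℤ) ≤ n := by exact_mod_cast hl
    nlinarith [sq_nonneg (n : ℤ)]
  rcases hs with ⟨h1, h2, h3⟩ | ⟨h1, h2, h3⟩
  · obtain rfl : y = y' := h1
    change y < k at h2
    change x + 1 = x' ∨ x' + 1 = x at h3
    by_cases hy : y ≤ y₀
    · rcases h3 with rfl | rfl
      · rw [potential_succ_left hy]
      · rw [potential_succ_left hy]
        omega
    · have hy' : min y y₀ = y₀ := min_eq_right (by omega)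
      rcases h3 with rfl | rfl
      · have h4 : ∑ i ∈ Finset.Ioc y₀ y, (cost n k T X (max (x + 1) T) i : ℤ) ≤
            ∑ i ∈ Finset.Ioc y₀ y, (cost n k T X (max x T) i : ℤ) := by
          refine Finset.sum_le_sum fun i _ => ?_
          by_cases hx : T ≤ x
          · rw [max_eq_left hx, max_eq_left (by omega)]
            exact_mod_cast (cost_succ_left hX hx (by omega)).1
          · rw [max_eq_right (by omega), max_eq_right (by omega)]
        have h5 := cost_mono_right (T := T) hX (x := x + 1) (show y₀ ≤ y by omega) h2
        rw [potential, potential, hy', Finset.sum_range_succ _ (x + 1)]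
        omega
      · rw [potential, potential, hy', Finset.sum_range_succ _ (x' + 1)]
        by_cases hx : T ≤ x'
        · have h4 : ∑ i ∈ Finset.Ioc y₀ y, (cost n k T X (max x' T) i : ℤ) ≤
              ∑ i ∈ Finset.Ioc y₀ y, (cost n k T X (max (x' + 1) T) i + 8 * n ^ 2 : ℤ) := by
            refine Finset.sum_le_sum fun i _ => ?_
            rw [max_eq_left hx, max_eq_left (by omega)]
            exact_mod_cast (cost_succ_left hX hx (by omega)).2
          rw [Finset.sum_add_distrib, Finset.sum_const, Nat.card_Ioc, nsmul_eq_mul] at h4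
          have h5 := hbig (y - y₀) (by omega)
          have h6 := le_cost (n := n) (X := X) (show T ≤ x' ∧ x' < T + k ∧ y < k by omega)
          zify at h6
          omega
        · rw [max_eq_right (show x' ≤ T by omega), max_eq_right (show x' + 1 ≤ T by omega)]
          omega
  · obtain rfl : x = x' := h1
    change T ≤ x at h2
    change y + 1 = y' ∨ y' + 1 = y at h3
    rcases h3 with rfl | rfl
    · by_cases hy : y₀ ≤ y
      · rw [potential_succ_right h2 hy]
      · have h4 : ∑ i ∈ Finset.range (x + 1), (cost n k T X i (y + 1) : ℤ) ≤
            ∑ i ∈ Finset.range (x + 1), (cost n k T X i y + 8 * n ^ 2 : ℤ) := by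
          refine Finset.sum_le_sum fun i _ => ?_
          exact_mod_cast (cost_succ_right hX (by omega)).2
        rw [Finset.sum_add_distrib, Finset.sum_const, Finset.card_range, nsmul_eq_mul] at h4
        have h5 := hbig (x + 1) (by omega)
        have h6 := le_cost (n := n) (X := X) (show T ≤ x ∧ x < T + k ∧ y + 1 < k by omega)
        zify at h6
        rw [potential, potential, Finset.Ioc_eq_empty (by omega), Finset.Ioc_eq_empty (by omega),
          min_eq_left (by omega), min_eq_left (by omega)]
        simp only [Finset.sum_empty]
        omega
    · by_cases hy : y₀ ≤ y'
      · rw [potential_succ_right h2 hy]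
        omega
      · have h4 : ∑ i ∈ Finset.range (x + 1), (cost n k T X i y' : ℤ) ≤
            ∑ i ∈ Finset.range (x + 1), (cost n k T X i (y' + 1) : ℤ) := by
          refine Finset.sum_le_sum fun i _ => ?_
          exact_mod_cast (cost_succ_right hX (by omega)).1
        rw [potential, potential, Finset.Ioc_eq_empty (by omega), Finset.Ioc_eq_empty (by omega),
          min_eq_left (by omega), min_eq_left (by omega)]
        simp only [Finset.sum_empty]
        omega

/-- Weights that agree on the row up to a cell and on the column beyond it, and lead to nearly the
same distance, agree on the cell. -/
theorem eq_of_potential_near {n k T y₀ p j y₁ a : ℕ} {X X' : ℕ → ℕ → ℕ} (hT : T < n)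
    (hy₀ : y₀ < k) (hp : p < T) (hj : j < k) (hy₁ : y₀ ≤ y₁)
    (hrow : ∀ i < j, X i y₀ = X' i y₀) (hcol : ∀ y, y₀ < y → y < k → X j y = X' j y)
    (h : |(1 + a : ℤ) * (potential (cost n k T X) T y₀ (T + j) y₁ -
        potential (cost n k T X) T y₀ p y₀) -
      (1 + a : ℤ) * (potential (cost n k T X') T y₀ (T + j) y₁ -
        potential (cost n k T X') T y₀ p y₀)| ≤ 4 * T) :
    X j y₀ = X' j y₀ := by
  have h1 : potential (cost n k T X) T y₀ p y₀ = potential (cost n k T X') T y₀ p y₀ := by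
    simp only [potential, Finset.Ioc_self, Finset.sum_empty, min_self]
    congr 1
    refine Finset.sum_congr rfl fun i hi => ?_
    rw [Finset.mem_range] at hi
    rw [cost_of_not_square (by omega), cost_of_not_square (by omega)]
  have h2 : potential (cost n k T X) T y₀ (T + j) y₁ - potential (cost n k T X') T y₀ (T + j) y₁ =
      4 * n * (X j y₀ - X' j y₀) := by
    simp only [potential, min_eq_right hy₁, max_eq_left (Nat.le_add_right T j),
      Finset.sum_range_succ _ (T + j)]
    have h3 : ∑ i ∈ Finset.range (T + j), (cost n k T X i y₀ : ℤ) =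
        ∑ i ∈ Finset.range (T + j), (cost n k T X' i y₀ : ℤ) := by
      refine Finset.sum_congr rfl fun i hi => ?_
      rw [Finset.mem_range] at hi
      by_cases hi' : T ≤ i
      · rw [cost_of_square (by omega), cost_of_square (by omega), hrow _ (by omega)]
      · rw [cost_of_not_square (by omega), cost_of_not_square (by omega)]
    have h4 : ∑ i ∈ Finset.Ioc y₀ y₁, (cost n k T X (T + j) i : ℤ) =
        ∑ i ∈ Finset.Ioc y₀ y₁, (cost n k T X' (T + j) i : ℤ) := by
      refine Finset.sum_congr rfl fun i hi => ?_
      rw [Finset.mem_Ioc] at hi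
      by_cases hi' : i < k
      · rw [cost_of_square (by omega), cost_of_square (by omega), Nat.add_sub_cancel_left,
          hcol _ hi.1 hi']
      · rw [cost_of_not_square (by omega), cost_of_not_square (by omega)]
    rw [h3, h4, cost_of_square (by omega), cost_of_square (by omega), Nat.add_sub_cancel_left]
    push_cast
    ring
  have h5 : ((1 + a : ℤ) * (potential (cost n k T X) T y₀ (T + j) y₁ -
        potential (cost n k T X) T y₀ p y₀) -
      (1 + a : ℤ) * (potential (cost n k T X') T y₀ (T + j) y₁ -
        potential (cost n k T X') T y₀ p y₀)) = (1 + a) * (4 * n) * (X j y₀ - X' j y₀) := by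
    rw [h1, ← mul_sub, sub_sub_sub_cancel_right, h2]
    ring
  rw [h5, abs_mul] at h
  -- Distinct entries would shift the distance by at least `4 * n`, more than the tolerance `4 * T`.
  by_contra hne
  have h6 : (1 : ℤ) ≤ |(X j y₀ : ℤ) - X' j y₀| :=
    Int.one_le_abs (sub_ne_zero.2 (by exact_mod_cast hne))
  have h7 : (4 * n : ℤ) ≤ |(1 + a : ℤ) * (4 * n)| := by
    rw [abs_of_nonneg (by positivity)]
    nlinarith [Int.natCast_nonneg a, Int.natCast_nonneg n]
  have h8 : (4 * n : ℤ) ≤ 4 * T := by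
    refine le_trans ?_ h
    nlinarith [abs_nonneg ((1 + a : ℤ) * (4 * n))]
  omega

/-! ### The grid graph and its A* runs. -/

/-- A numbering of the cells. -/
structure Layout (n k T r : ℕ) where
  pos : Fin n → ℕ × ℕ
  injective : Function.Injective pos
  mem_iff : ∀ a, a ∈ cells k T r ↔ ∃ v, pos v = a
  k_pos : 0 < k

theorem Layout.exists_of_card {n k T r : ℕ} (hk : 0 < k) (h : (T + k) * k + k * T + r = n) :
    Nonempty (Layout n k T r) := by
  have e := Finset.equivFinOfCardEq ((card_cells k T r).trans h)
  refine ⟨⟨fun v => (e.symm v : ℕ × ℕ), fun u v huv => ?_, fun a => ⟨fun ha => ⟨e ⟨a, ha⟩, by simp⟩,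
    ?_⟩, hk⟩⟩
  · exact e.symm.injective (Subtype.ext huv)
  · rintro ⟨v, rfl⟩
    exact (e.symm v).2

namespace Layout

variable {n k T r : ℕ} (P : Layout n k T r)

theorem pos_mem (v : Fin n) : P.pos v ∈ cells k T r := (P.mem_iff _).2 ⟨v, rfl⟩

include P in
theorem nonempty : Nonempty (Fin n) := by
  have := P.k_pos
  obtain ⟨v, _⟩ := (P.mem_iff (0, 0)).1 (mem_cells.2 (by omega))
  exact ⟨v⟩

/-- The vertex at a cell. -/
noncomputable def vertex (x y : ℕ) : Fin n :=
  haveI := P.nonempty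
  Function.invFun P.pos (x, y)

theorem pos_vertex {x y : ℕ} (h : (x, y) ∈ cells k T r) : P.pos (P.vertex x y) = (x, y) :=
  haveI := P.nonempty
  Function.invFun_eq ((P.mem_iff _).1 h)

theorem vertex_pos (v : Fin n) : P.vertex (P.pos v).1 (P.pos v).2 = v :=
  P.injective (P.pos_vertex (P.pos_mem v))

/-- The graph of the steps between the cells. -/
def graph : SimpleGraph (Fin n) where
  Adj u v := Step k T (P.pos u) (P.pos v)
  symm := ⟨fun u v h => by simp only [Step] at *; omega⟩
  loopless := ⟨fun u h => by simp only [Step] at *; omega⟩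

theorem adj_left {x y : ℕ} (h : (x + 1, y) ∈ cells k T r) (hy : y < k) :
    P.graph.Adj (P.vertex x y) (P.vertex (x + 1) y) := by
  have h' : (x, y) ∈ cells k T r := by rw [mem_cells] at h ⊢; omega
  change Step k T _ _
  rw [P.pos_vertex h, P.pos_vertex h']
  exact Or.inl ⟨rfl, hy, Or.inl rfl⟩

theorem adj_right {x y : ℕ} (h : (x, y + 1) ∈ cells k T r) (hx : T ≤ x) :
    P.graph.Adj (P.vertex x y) (P.vertex x (y + 1)) := by
  have h' : (x, y) ∈ cells k T r := by rw [mem_cells] at h ⊢; omega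
  change Step k T _ _
  rw [P.pos_vertex h, P.pos_vertex h']
  exact Or.inr ⟨rfl, hx, Or.inl rfl⟩

/-- Rows are linked only from column `T` on: cells in the first `k` rows are reached through column
`T`, and the column trails through row 0. -/
theorem graph_connected : P.graph.Connected := by
  have hk := P.k_pos
  have hrow : ∀ x y, (x, y) ∈ cells k T r → y < k →
      P.graph.Reachable (P.vertex 0 y) (P.vertex x y) := by
    intro x y hm hy
    induction x with
    | zero => exact .rfl
    | succ x ih =>
      exact (ih (by rw [mem_cells] at hm ⊢; omega)).trans (P.adj_left hm hy).reachable
  have hcol : ∀ x y, (x, y) ∈ cells k T r → T ≤ x →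
      P.graph.Reachable (P.vertex x 0) (P.vertex x y) := by
    intro x y hm hx
    induction y with
    | zero => exact .rfl
    | succ y ih =>
      exact (ih (by rw [mem_cells] at hm ⊢; omega)).trans (P.adj_right hm hx).reachable
  have hall : ∀ v, P.graph.Reachable (P.vertex 0 0) v := by
    intro v
    have hm := P.pos_mem v
    rw [← P.vertex_pos v]
    generalize hx : (P.pos v).1 = x
    generalize hy : (P.pos v).2 = y
    rw [← Prod.mk.eta (p := P.pos v), hx, hy] at hm
    by_cases hyk : y < k
    · have h1 : (T, y) ∈ cells k T r := by rw [mem_cells]; omega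
      have h2 : (T, 0) ∈ cells k T r := by rw [mem_cells]; omega
      exact (hrow T 0 h2 hk).trans ((hcol T y h1 le_rfl).trans
        ((hrow T y h1 hyk).symm.trans (hrow x y hm hyk)))
    · rw [mem_cells] at hm
      have h1 : (x, 0) ∈ cells k T r := by rw [mem_cells]; omega
      exact (hrow x 0 h1 hk).trans (hcol x y (by rw [mem_cells]; omega) (by omega))
  have := P.nonempty
  exact ⟨fun u v => (hall u).symm.trans (hall v)⟩

/-- The weight of the cell of a vertex. -/
def vertexCost (X : ℕ → ℕ → ℕ) (v : Fin n) : ℕ := cost n k T X (P.pos v).1 (P.pos v).2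

/-- The weighted grid graph that encodes the matrix `X`. -/
def grid (hn : 0 < n) (M : WeightModel) (X : ℕ → ℕ → ℕ) : WeightedGrid n where
  cell v := ((P.pos v).1, (P.pos v).2)
  cell_injective u v h := by
    simp only [Prod.mk.injEq, Nat.cast_inj] at h
    exact P.injective (Prod.ext h.1 h.2)
  graph := P.graph
  adj_cell u v h := by
    change Step k T _ _ at h
    simp only [Step] at h
    rcases h with ⟨h1, _, h3⟩ | ⟨h1, _, h3⟩
    · rw [h1, sub_self, abs_zero, add_zero]
      rcases h3 with h3 | h3 <;> rw [← h3] <;> simp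
    · rw [h1, sub_self, abs_zero, zero_add]
      rcases h3 with h3 | h3 <;> rw [← h3] <;> simp
  connected := P.graph_connected
  w u v := M.startFactor * P.vertexCost X u + P.vertexCost X v
  w_pos u v _ := Nat.add_pos_right _ (cost_pos hn _ _)

theorem grid_mem_instances {M : WeightModel} {X : ℕ → ℕ → ℕ} (hX : ∀ j y, X j y ≤ n)
    (hkT : T + k ≤ n) (hn : 40 ≤ n) {C : ℕ} (hC : n ^ 6 ≤ C) :
    P.grid (by omega) M X ∈ WeightedGrid.instances M n C := by
  refine ⟨?_, le_trans ?_ hC⟩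
  · cases M
    · intro u v _
      simp [grid, WeightModel.startFactor, add_comm]
    · exact ⟨P.vertexCost X, fun u v _ => by simp [grid, WeightModel.startFactor]⟩
  · have h1 : ∀ u v, (P.grid (by omega) M X).w u v ≤ 40 * n ^ 3 := by
      intro u v
      have h1 : P.vertexCost X u ≤ 20 * n ^ 3 := cost_le hX (by omega) hkT _ _
      have h2 : P.vertexCost X v ≤ 20 * n ^ 3 := cost_le hX (by omega) hkT _ _
      have h3 := Nat.mul_le_mul M.startFactor_le_one h1
      change M.startFactor * P.vertexCost X u + P.vertexCost X v ≤ _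
      omega
    calc (P.grid (by omega) M X).totalWeight
        ≤ ∑ _u : Fin n, ∑ _v : Fin n, 40 * n ^ 3 := by
          refine Finset.sum_le_sum fun u _ => Finset.sum_le_sum fun v _ => ?_
          split_ifs
          · exact h1 u v
          · exact Nat.zero_le _
      _ = 40 * n ^ 5 := by
          simp only [Finset.sum_const, Finset.card_univ, Fintype.card_fin, smul_eq_mul]
          ring
      _ ≤ n * n ^ 5 := by gcongr
      _ = n ^ 6 := by ring

/-- The potential for the distances from the row `y₀` under the step costs of the model. -/
def gridPotential (M : WeightModel) (X : ℕ → ℕ → ℕ) (y₀ : ℕ) (v : Fin n) : ℤ :=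
  (1 + M.startFactor) * potential (cost n k T X) T y₀ (P.pos v).1 (P.pos v).2 -
    M.startFactor * P.vertexCost X v

variable {P} {hn : 0 < n} {M : WeightModel} {X : ℕ → ℕ → ℕ}

/-- With `a` the start factor, `a * c u + c v` is `(1 + a) * c v` plus the telescoping term `a * (c
u - c v)`, which the correction in `gridPotential` absorbs. Thus both models reduce to cell weights.
-/
theorem gridPotential_feasible (hX : ∀ j y, X j y ≤ n) (hkT : T + k ≤ n) {y₀ : ℕ} (hy₀ : y₀ < k)
    (u v : Fin n) (huv : (P.grid hn M X).graph.Adj u v) :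
    P.gridPotential M X y₀ v ≤ P.gridPotential M X y₀ u + (P.grid hn M X).w u v := by
  have h1 := potential_feasible (r := r) hX hkT hy₀ (P.pos_mem u) (P.pos_mem v) huv
  have h2 := mul_le_mul_of_nonneg_left h1 (show (0 : ℤ) ≤ 1 + M.startFactor by positivity)
  simp only [gridPotential, grid, vertexCost]
  push_cast
  linarith

theorem gridPotential_tight {y₀ : ℕ} {u v : Fin n}
    (h : potential (cost n k T X) T y₀ (P.pos v).1 (P.pos v).2 =
      potential (cost n k T X) T y₀ (P.pos u).1 (P.pos u).2 + P.vertexCost X v) :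
    P.gridPotential M X y₀ v = P.gridPotential M X y₀ u + (P.grid hn M X).w u v := by
  simp only [gridPotential, grid, h]
  push_cast
  ring

/-- A consistent heuristic does not overestimate the distance along a row and a column. -/
theorem heuristic_add_potential_le {h : Fin n → Fin n → ℕ}
    (hc : (P.grid hn M X).IsConsistent h) {y₀ p j y₁ : ℕ} (hy₀ : y₀ < k) (hp : p < T) (hj : j < k)
    (hy₁ : y₀ ≤ y₁) (hm : (T + j, y₁) ∈ cells k T r) :
    h (P.vertex p y₀) (P.vertex (T + j) y₁) + P.gridPotential M X y₀ (P.vertex p y₀) ≤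
      P.gridPotential M X y₀ (P.vertex (T + j) y₁) := by
  set t := P.vertex (T + j) y₁ with ht
  have hrow : ∀ x, p ≤ x → x < T + k →
      h (P.vertex p y₀) t + P.gridPotential M X y₀ (P.vertex p y₀) ≤
        h (P.vertex x y₀) t + P.gridPotential M X y₀ (P.vertex x y₀) := by
    intro x hx hx'
    induction x, hx using Nat.le_induction with
    | base => exact le_rfl
    | succ x hx ih =>
      have h1 : (x + 1, y₀) ∈ cells k T r := by rw [mem_cells]; omega
      have h2 : (x, y₀) ∈ cells k T r := by rw [mem_cells]; omega
      refine (ih (by omega)).trans (hc.add_le_add (P.adj_left h1 hy₀) (gridPotential_tight ?_))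
      rw [vertexCost, P.pos_vertex h1, P.pos_vertex h2, potential_succ_left le_rfl]
  have hcol : ∀ y, y₀ ≤ y → y ≤ y₁ →
      h (P.vertex p y₀) t + P.gridPotential M X y₀ (P.vertex p y₀) ≤
        h (P.vertex (T + j) y) t + P.gridPotential M X y₀ (P.vertex (T + j) y) := by
    intro y hy hy'
    induction y, hy using Nat.le_induction with
    | base => exact hrow _ (by omega) (by omega)
    | succ y hy ih =>
      have h1 : (T + j, y + 1) ∈ cells k T r := by rw [mem_cells] at hm ⊢; omega
      have h2 : (T + j, y) ∈ cells k T r := by rw [mem_cells] at hm ⊢; omega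
      refine (ih (by omega)).trans
        (hc.add_le_add (P.adj_right h1 (by omega)) (gridPotential_tight ?_))
      rw [vertexCost, P.pos_vertex h1, P.pos_vertex h2, potential_succ_right (by omega) hy]
  have h1 := hcol y₁ hy₁ le_rfl
  rw [← ht, (hc t).1] at h1
  simpa using h1

/-- If the heuristic is too small, A* scans the whole trail of the source. -/
theorem le_card_of_gap (hX : ∀ j y, X j y ≤ n) (hkT : T + k ≤ n) {h : Fin n → Fin n → ℕ}
    (hc : (P.grid hn M X).IsConsistent h) {y₀ p : ℕ} (hy₀ : y₀ < k) (hp : p < T) {t : Fin n}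
    {S : Finset (Fin n)} (hS : (P.grid hn M X).IsScannedSet h (P.vertex p y₀) t S)
    (hgap : (h (P.vertex p y₀) t : ℤ) + 4 * T <
      P.gridPotential M X y₀ t - P.gridPotential M X y₀ (P.vertex p y₀)) :
    T ≤ S.card := by
  have hm : ∀ x < T, (x, y₀) ∈ cells k T r := fun x hx => by rw [mem_cells]; omega
  have hcost : ∀ x < T, P.vertexCost X (P.vertex x y₀) = 1 := by
    intro x hx
    rw [vertexCost, P.pos_vertex (hm x hx), cost_of_not_square]
    simp only
    omega
  have hw : ∀ x < T, ∀ x' < T,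
      (P.grid hn M X).w (P.vertex x y₀) (P.vertex x' y₀) ≤ 2 := by
    intro x hx x' hx'
    have := M.startFactor_le_one
    simp only [grid, hcost x hx, hcost x' hx']
    omega
  have hadj : ∀ x, x + 1 < T → (P.grid hn M X).graph.Adj (P.vertex x y₀) (P.vertex (x + 1) y₀) :=
    fun x hx => P.adj_left (hm _ hx) hy₀
  have hΨ := gridPotential_feasible (P := P) (hn := hn) (M := M) hX hkT hy₀
  have hmem : ∀ x < T, P.vertex x y₀ ∈ S := by
    intro x hx
    -- From position `p` one path runs to each end of the trail. Each has fewer than `T` steps, of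
    -- cost at most 2, so a gap of `4 * T` suffices.
    rcases le_total p x with hpx | hpx
    · have := hS.mem_of_path hc hΨ (W := 2) (len := T - 1 - p) (fun i => P.vertex (p + i) y₀)
        (by simp) (fun i hi => hadj (p + i) (by omega)) (fun i hi => hw _ (by omega) _ (by omega))
        (fun i hi => hw _ (by omega) _ (by omega)) (by omega) (x - p) (by omega)
      rwa [show p + (x - p) = x by omega] at this
    · have := hS.mem_of_path hc hΨ (W := 2) (len := p) (fun i => P.vertex (p - i) y₀)
        (by simp)
        (fun i hi => by
          have h1 := (hadj (p - (i + 1)) (by omega)).symm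
          rwa [show p - (i + 1) + 1 = p - i by omega] at h1)
        (fun i hi => hw _ (by omega) _ (by omega))
        (fun i hi => hw _ (by omega) _ (by omega)) (by omega) (p - x) (by omega)
      rwa [show p - (p - x) = x by omega] at this
  have hinj : Set.InjOn (fun x => P.vertex x y₀) (Finset.range T : Set ℕ) := by
    intro x hx x' hx' hxx
    have h1 := congrArg P.pos hxx
    simp only at h1
    rw [P.pos_vertex (hm x (by simpa using hx)), P.pos_vertex (hm x' (by simpa using hx'))] at h1
    exact congrArg Prod.fst h1
  calc T = (Finset.range T).card := (Finset.card_range T).symm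
    _ ≤ S.card := Finset.card_le_card_of_injOn _ (fun x hx => hmem x (by simpa using hx)) hinj

end Layout

end CrossingGrid

/-! ### Encoding and recovering the matrix. -/

/-- If every word is determined by its code, a set of at most `m` positions and its letters there,
then there are few words. -/
theorem card_pow_le_of_decode {ι β γ : Type*} [Fintype ι] [DecidableEq ι] [Fintype β]
    [DecidableEq β] [Fintype γ] [DecidableEq γ] (hβ : 0 < Fintype.card β) (code : (ι → β) → γ)
    (B : (ι → β) → Finset ι) (m : ℕ) (hB : ∀ A, (B A).card ≤ m)
    (hdec : ∀ A A', code A = code A' → B A = B A' → (∀ i ∈ B A, A i = A' i) → A = A') :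
    Fintype.card β ^ Fintype.card ι ≤
      Fintype.card β ^ m * (Fintype.card γ * 2 ^ Fintype.card ι) := by
  have h1 := Finset.card_le_mul_card_image (f := fun A => (code A, B A))
    (Finset.univ : Finset (ι → β)) (Fintype.card β ^ m) (by
      rintro ⟨x, b⟩ hb
      obtain ⟨A₀, _, hA₀⟩ := Finset.mem_image.1 hb
      have hbm : b.card ≤ m := by
        rw [Prod.mk.injEq] at hA₀
        exact hA₀.2 ▸ hB A₀
      calc _ ≤ (Finset.univ : Finset (b → β)).card := by
            refine Finset.card_le_card_of_injOn (fun A i => A i) (fun _ _ => Finset.mem_univ _) ?_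
            intro A hA A' hA' hAA
            simp only [Finset.coe_filter, Finset.mem_univ, true_and, Set.mem_ofPred_eq,
              Prod.mk.injEq] at hA hA'
            refine hdec A A' (hA.1.trans hA'.1.symm) (hA.2.trans hA'.2.symm) fun i hi => ?_
            exact congrFun hAA ⟨i, hA.2 ▸ hi⟩
        _ = Fintype.card β ^ b.card := by simp
        _ ≤ Fintype.card β ^ m := Nat.pow_le_pow_right hβ hbm)
  calc Fintype.card β ^ Fintype.card ι = (Finset.univ : Finset (ι → β)).card := by simp
    _ ≤ _ := h1
    _ ≤ _ := by
      gcongr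
      refine (Finset.card_le_univ _).trans ?_
      simp

namespace CrossingGrid

/-- A square matrix, extended by zero. -/
def extend {n k : ℕ} (A : Fin k × Fin k → Fin n) (j y : ℕ) : ℕ :=
  if h : j < k ∧ y < k then A (⟨j, h.1⟩, ⟨y, h.2⟩) else 0

theorem extend_le {n k : ℕ} (A : Fin k × Fin k → Fin n) (j y : ℕ) : extend A j y ≤ n := by
  rw [extend]
  split_ifs with h
  · exact (A _).2.le
  · exact Nat.zero_le _

theorem extend_fin {n k : ℕ} (A : Fin k × Fin k → Fin n) (j y : Fin k) :
    extend A j y = A (j, y) := by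
  rw [extend, dif_pos ⟨j.2, y.2⟩]

namespace Layout

variable {n k T r : ℕ} (P : Layout n k T r)

/-- The vertex in position `p` of the trail of row `y`. -/
noncomputable def source (p : Fin T) (y : Fin k) : Fin n := P.vertex p y

/-- The vertex in position `q` of the trail of column `j`. -/
noncomputable def target (q : Fin T) (j : Fin k) : Fin n := P.vertex (T + j) (k + q)

theorem source_mem (p : Fin T) (y : Fin k) : ((p : ℕ), (y : ℕ)) ∈ cells k T r := by
  rw [mem_cells]; omega

theorem target_mem (q : Fin T) (j : Fin k) : (T + j, k + q) ∈ cells k T r := by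
  rw [mem_cells]; omega

theorem pos_source (p : Fin T) (y : Fin k) : P.pos (P.source p y) = ((p : ℕ), (y : ℕ)) :=
  P.pos_vertex (source_mem p y)

theorem pos_target (q : Fin T) (j : Fin k) : P.pos (P.target q j) = (T + j, k + q) :=
  P.pos_vertex (target_mem q j)

theorem source_target_injective : Function.Injective
    (fun x : (Fin T × Fin T) × (Fin k × Fin k) =>
      (P.source x.1.1 x.2.2, P.target x.1.2 x.2.1)) := by
  rintro ⟨⟨p, q⟩, ⟨j, y⟩⟩ ⟨⟨p', q'⟩, ⟨j', y'⟩⟩ h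
  simp only [Prod.mk.injEq] at h
  have h1 := congrArg P.pos h.1
  have h2 := congrArg P.pos h.2
  rw [pos_source, pos_source, Prod.mk.injEq] at h1
  rw [pos_target, pos_target, Prod.mk.injEq] at h2
  simp only [Prod.mk.injEq, Fin.ext_iff]
  omega

/-- The distance from a source to a target. -/
def distance (M : WeightModel) (X : ℕ → ℕ → ℕ) (p q : Fin T) (j y : Fin k) : ℤ :=
  (1 + M.startFactor : ℤ) * (potential (cost n k T X) T y (T + j) (k + q) -
    potential (cost n k T X) T y p y)

/-- Both endpoints lie on trails and have weight 1, so their corrections cancel. -/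
theorem gridPotential_sub (M : WeightModel) (X : ℕ → ℕ → ℕ) (p q : Fin T) (j y : Fin k) :
    P.gridPotential M X y (P.target q j) - P.gridPotential M X y (P.source p y) =
      distance (n := n) M X p q j y := by
  have h1 : P.vertexCost X (P.target q j) = 1 := by
    rw [vertexCost, pos_target, cost_of_not_square]
    simp only
    omega
  have h2 : P.vertexCost X (P.source p y) = 1 := by
    rw [vertexCost, pos_source, cost_of_not_square]
    simp only
    omega
  simp only [gridPotential, h1, h2, pos_source, pos_target, distance]
  ring

variable (hn : 0 < n) (M : WeightModel)

open Classical in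
/-- The pairs of a column and a row for which the heuristic is far from the distance between the
given positions of their trails. -/
noncomputable def badPairs (h : Fin n → Fin n → ℕ) (X : ℕ → ℕ → ℕ) (p q : Fin T) :
    Finset (Fin k × Fin k) :=
  {x | (h (P.source p x.2) (P.target q x.1) : ℤ) + 4 * T < distance (n := n) M X p q x.1 x.2}

variable {hn} {M}

/-- Bad pairs at the various positions are distinct queries, and each of them scans a full trail. -/
theorem sum_card_badPairs_le {X : ℕ → ℕ → ℕ} (hX : ∀ j y, X j y ≤ n) (hkT : T + k ≤ n)
    {h : Fin n → Fin n → ℕ} (hc : (P.grid hn M X).IsConsistent h)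
    {S : Fin n → Fin n → Finset (Fin n)}
    (hS : ∀ s t, (P.grid hn M X).IsScannedSet h s t (S s t)) :
    T * ∑ x : Fin T × Fin T, (P.badPairs M h X x.1 x.2).card ≤ ∑ s, ∑ t, (S s t).card := by
  calc T * ∑ x : Fin T × Fin T, (P.badPairs M h X x.1 x.2).card
      = ∑ x : Fin T × Fin T, ∑ _z ∈ P.badPairs M h X x.1 x.2, T := by
        simp [Finset.mul_sum, mul_comm]
    _ ≤ ∑ x : Fin T × Fin T, ∑ z ∈ P.badPairs M h X x.1 x.2,
          (S (P.source x.1 z.2) (P.target x.2 z.1)).card := by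
        refine Finset.sum_le_sum fun x _ => Finset.sum_le_sum fun z hz => ?_
        refine P.le_card_of_gap hX hkT hc z.2.2 x.1.2 (hS _ _) ?_
        change _ < P.gridPotential M X z.2 _ - P.gridPotential M X z.2 (P.source x.1 z.2)
        rw [gridPotential_sub]
        exact (Finset.mem_filter.1 hz).2
    _ ≤ ∑ x : Fin T × Fin T, ∑ z : Fin k × Fin k,
          (S (P.source x.1 z.2) (P.target x.2 z.1)).card :=
        Finset.sum_le_sum fun x _ => Finset.sum_le_sum_of_subset (Finset.subset_univ _)
    _ = ∑ x : (Fin T × Fin T) × (Fin k × Fin k),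
          (S (P.source x.1.1 x.2.2) (P.target x.1.2 x.2.1)).card :=
        (Fintype.sum_prod_type (fun x : (Fin T × Fin T) × (Fin k × Fin k) =>
          (S (P.source x.1.1 x.2.2) (P.target x.1.2 x.2.1)).card)).symm
    _ = ∑ x ∈ Finset.univ.map ⟨_, P.source_target_injective⟩, (S x.1 x.2).card := by
        rw [Finset.sum_map]
        rfl
    _ ≤ ∑ x : Fin n × Fin n, (S x.1 x.2).card :=
        Finset.sum_le_sum_of_subset (Finset.subset_univ _)
    _ = _ := by rw [Fintype.sum_prod_type]

/-- Equal labels give equal heuristic values. Off the common bad set both distances lie between this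
value and `4 * T` above it, so they are close enough to force equal entries. -/
theorem decode {L C : ℕ} {H : LabelingScheme n L C} (hT : T < n)
    {A A' : Fin k × Fin k → Fin n}
    (hc : (P.grid hn M (extend A)).IsConsistent (H.heuristic (P.grid hn M (extend A))))
    (hc' : (P.grid hn M (extend A')).IsConsistent (H.heuristic (P.grid hn M (extend A'))))
    {p q : Fin T}
    (hs : ∀ y, H.f (P.grid hn M (extend A)) (P.source p y) =
      H.f (P.grid hn M (extend A')) (P.source p y))
    (ht : ∀ j, H.f (P.grid hn M (extend A)) (P.target q j) =
      H.f (P.grid hn M (extend A')) (P.target q j))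
    (hB : P.badPairs M (H.heuristic (P.grid hn M (extend A))) (extend A) p q =
      P.badPairs M (H.heuristic (P.grid hn M (extend A'))) (extend A') p q)
    (hA : ∀ x ∈ P.badPairs M (H.heuristic (P.grid hn M (extend A))) (extend A) p q, A x = A' x) :
    A = A' := by
  -- The other entries that enter the distance, at smaller columns in row `y` and at larger rows in
  -- column `j`, have a smaller `j + (k - y)`.
  have key : ∀ N, ∀ j y : Fin k, j + (k - y) = N → A (j, y) = A' (j, y) := by
    intro N
    induction N using Nat.strong_induction_on with
    | _ N ih =>
      intro j y hN
      by_cases hbad : (j, y) ∈ P.badPairs M (H.heuristic (P.grid hn M (extend A))) (extend A) p q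
      · exact hA _ hbad
      · have hbad' := hbad
        rw [hB] at hbad'
        simp only [badPairs, Finset.mem_filter, Finset.mem_univ, true_and, not_lt]
          at hbad hbad'
        have h1 := heuristic_add_potential_le hc y.2 p.2 j.2 (y₁ := k + q) (by omega)
          (target_mem q j)
        have h1' := heuristic_add_potential_le hc' y.2 p.2 j.2 (y₁ := k + q) (by omega)
          (target_mem q j)
        change _ + P.gridPotential M (extend A) y (P.source p y) ≤
          P.gridPotential M (extend A) y (P.target q j) at h1
        change _ + P.gridPotential M (extend A') y (P.source p y) ≤
          P.gridPotential M (extend A') y (P.target q j) at h1'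
        have h2 := P.gridPotential_sub M (extend A) p q j y
        have h2' := P.gridPotential_sub M (extend A') p q j y
        have h3 : H.heuristic (P.grid hn M (extend A)) (P.source p y) (P.target q j) =
            H.heuristic (P.grid hn M (extend A')) (P.source p y) (P.target q j) := by
          rw [LabelingScheme.heuristic, LabelingScheme.heuristic, hs, ht]
        change (H.heuristic (P.grid hn M (extend A)) (P.source p y) (P.target q j) : ℤ) + _ ≤ _
          at h1
        change (H.heuristic (P.grid hn M (extend A')) (P.source p y) (P.target q j) : ℤ) + _ ≤ _
          at h1'
        have h4 : |distance (n := n) M (extend A) p q j y -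
            distance (n := n) M (extend A') p q j y| ≤ 4 * T := by
          rw [abs_le]
          constructor <;> omega
        have h5 := eq_of_potential_near hT y.2 p.2 j.2 (by omega) (fun i hi => ?_)
          (fun i hi hi' => ?_) h4
        · rw [extend_fin, extend_fin] at h5
          exact Fin.ext h5
        · have := ih _ (by simp only; omega) ⟨i, by omega⟩ y rfl
          rw [← Fin.val_inj, ← extend_fin, ← extend_fin] at this
          exact this
        · have := ih _ (by simp only; omega) j ⟨i, hi'⟩ rfl
          rw [← Fin.val_inj, ← extend_fin, ← extend_fin] at this
          exact this
  funext ⟨j, y⟩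
  exact key _ j y rfl

include P in
/-- If the labels are too short for the number of matrices, A* scans many vertices on some grid. -/
theorem exists_grid_scanned {L C : ℕ} (H : LabelingScheme n L C) (M : WeightModel)
    (hkT : T + k ≤ n) (hn : 40 ≤ n) (hC : n ^ 6 ≤ C)
    (hH : ∀ G ∈ WeightedGrid.instances M n C, G.IsConsistent (H.heuristic G))
    (hcount : n ^ (k * k / 2) * ((T * T * (((C + 1) ^ L) ^ k * ((C + 1) ^ L) ^ k)) *
      2 ^ (k * k)) < n ^ (k * k)) :
    ∃ G ∈ WeightedGrid.instances M n C, ∀ S : Fin n → Fin n → Finset (Fin n),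
      (∀ s t, G.IsScannedSet (H.heuristic G) s t (S s t)) →
      T * (T * T * (k * k)) ≤ 2 * ∑ s, ∑ t, (S s t).card := by
  classical
  by_contra! hcon
  have hmem : ∀ A : Fin k × Fin k → Fin n,
      P.grid (by omega) M (extend A) ∈ WeightedGrid.instances M n C :=
    fun A => P.grid_mem_instances (extend_le A) hkT hn hC
  -- Otherwise more than half of the pairs are bad at all `T * T` positions, and their trails
  -- already exceed the assumed bound on the scans.
  have hpos : ∀ A : Fin k × Fin k → Fin n, ∃ x : Fin T × Fin T,
      (P.badPairs M (H.heuristic (P.grid (by omega) M (extend A))) (extend A) x.1 x.2).card ≤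
        k * k / 2 := by
    intro A
    obtain ⟨S, hS, hlt⟩ := hcon _ (hmem A)
    have h1 := P.sum_card_badPairs_le (extend_le A) hkT (hH _ (hmem A)) hS
    by_contra! hbig
    have h2 : ∑ _x : Fin T × Fin T, k * k ≤ 2 * ∑ x : Fin T × Fin T,
        (P.badPairs M (H.heuristic (P.grid (by omega) M (extend A))) (extend A) x.1 x.2).card := by
      rw [Finset.mul_sum]
      refine Finset.sum_le_sum fun x _ => ?_
      have := hbig x
      omega
    simp only [Finset.sum_const, Finset.card_univ, Fintype.card_prod, Fintype.card_fin,
      smul_eq_mul] at h2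
    have h3 := Nat.mul_le_mul_left T h2
    rw [mul_left_comm T 2] at h3
    omega
  choose x hx using hpos
  have h := card_pow_le_of_decode (ι := Fin k × Fin k) (β := Fin n) (by simp; omega)
    -- The good positions depend on the matrix, so they are part of the code. One source per row and
    -- one target per column then suffice.
    (fun A => (x A, fun y => H.f (P.grid (by omega) M (extend A)) (P.source (x A).1 y),
      fun j => H.f (P.grid (by omega) M (extend A)) (P.target (x A).2 j)))
    (fun A => P.badPairs M (H.heuristic (P.grid (by omega) M (extend A))) (extend A)
      (x A).1 (x A).2) (k * k / 2) hx (by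
      intro A A' hcode hB hA
      simp only [Prod.mk.injEq] at hcode
      obtain ⟨h1, h2, h3⟩ := hcode
      simp only [← h1] at h2 h3 hB
      exact P.decode (by have := P.k_pos; omega) (hH _ (hmem A)) (hH _ (hmem A'))
        (congrFun h2) (congrFun h3) hB hA)
  simp only [Fintype.card_prod, Fintype.card_fin, Fintype.card_fun] at h
  exact absurd h (not_le.2 hcount)

end Layout

end CrossingGrid

/-! ### Choice of parameters. -/

theorem labels_too_short {n k T C L K : ℕ} (hn : 2 ^ 16 ≤ n) (hk : 4 ≤ k) (hT : T ≤ n)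
    (hC : C + 1 ≤ n ^ K) (hL : 16 * (K * L) ≤ k) :
    n ^ (k * k / 2) * ((T * T * (((C + 1) ^ L) ^ k * ((C + 1) ^ L) ^ k)) * 2 ^ (k * k)) <
      n ^ (k * k) := by
  have hlab : ((C + 1) ^ L) ^ k ≤ n ^ (K * L * k) := by
    calc ((C + 1) ^ L) ^ k ≤ ((n ^ K) ^ L) ^ k := by gcongr
      _ = n ^ (K * L * k) := by rw [← pow_mul, ← pow_mul, mul_assoc]
  have hexp : 16 * (K * L * k) ≤ k * k := by
    rw [← mul_assoc]; exact Nat.mul_le_mul_right k hL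
  have hkk : 16 ≤ k * k := Nat.mul_le_mul hk hk
  set E := K * L * k
  -- In 16th powers, `2 ^ (k * k)` becomes `(2 ^ 16) ^ (k * k) ≤ n ^ (k * k)`. The exponents of `n`
  -- sum to at most `(8 + 2 + 2 + 1) * k² = 13 * k²`, below `16 * k²`.
  refine lt_of_pow_lt_pow_left₀ 16 (Nat.zero_le _) ?_
  calc (n ^ (k * k / 2) * ((T * T * (((C + 1) ^ L) ^ k * ((C + 1) ^ L) ^ k)) * 2 ^ (k * k))) ^ 16
      ≤ (n ^ (k * k / 2) * ((n * n * (n ^ E * n ^ E)) * 2 ^ (k * k))) ^ 16 := by gcongr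
    _ = n ^ (16 * (k * k / 2) + 32 + 32 * E) * (2 ^ 16) ^ (k * k) := by
        generalize k * k / 2 = a
        generalize k * k = b
        simp only [mul_pow, pow_add, ← pow_mul, mul_comm]
        ring
    _ ≤ n ^ (16 * (k * k / 2) + 32 + 32 * E) * n ^ (k * k) := by gcongr
    _ = n ^ (16 * (k * k / 2) + 32 + 32 * E + k * k) := (pow_add _ _ _).symm
    _ < n ^ (k * k * 16) := Nat.pow_lt_pow_right (by omega) (by omega)
    _ = (n ^ (k * k)) ^ 16 := pow_mul _ _ _

theorem mainTheorem6 (α : ℝ) (hα₀ : 0 ≤ α) (hα : α < 1 / 2) :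
    ∃ c : ℝ, 0 < c ∧
      ∀ (M : WeightModel) (L C : ℕ → ℕ),
        (fun n : ℕ => (L n : ℝ)) =o[atTop] (fun n : ℕ => (n : ℝ) ^ α) →
        (∃ K : ℕ, ∀ᶠ n in atTop, C n ≤ n ^ K) →
        (∀ᶠ n in atTop, n ^ 6 ≤ C n) →
        ∀ᶠ n : ℕ in atTop, ∀ H : LabelingScheme n (L n) (C n),
          (∀ G ∈ WeightedGrid.instances M n (C n), G.IsConsistent (H.heuristic G)) →
          ∃ G ∈ WeightedGrid.instances M n (C n),
            ∀ S : Fin n → Fin n → Finset (Fin n),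
              (∀ s t, G.IsScannedSet (H.heuristic G) s t (S s t)) →
              c * (n : ℝ) ^ (1 - α) ≤ (∑ s, ∑ t, ((S s t).card : ℝ)) / (n : ℝ) ^ 2 := by
  -- `6144 = 2 * 48 * 8 ^ 2`, from `n ^ (1 - α) ≤ 48 * T`, `n ≤ 8 * (k * T)` and the loss of one
  -- half in the count.
  refine ⟨1 / 6144, by norm_num, ?_⟩
  rintro M L C hL ⟨K, hK⟩ hC
  -- `144 = 4 * 6 ^ 2`: as `k ≤ 6 * n ^ α`, the square takes at most a quarter of the cells. This is
  -- where `α < 1 / 2` matters.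
  have hgrow : ∀ᶠ n : ℕ in atTop, (144 : ℝ) ≤ (n : ℝ) ^ (1 - 2 * α) :=
    ((tendsto_rpow_atTop (by linarith)).comp tendsto_natCast_atTop_atTop).eventually_ge_atTop 144
  have hL' := hL.bound (show (0 : ℝ) < 1 / (16 * (K + 1)) by positivity)
  filter_upwards [hgrow, hL', hK, hC, eventually_ge_atTop (2 ^ 16)] with n hgrow hL hK hC hn H hH
  have hn₁ : (1 : ℝ) ≤ n := by exact_mod_cast (by omega : 1 ≤ n)
  have hn₀ : (0 : ℝ) < n := by linarith
  have hnα : 1 ≤ (n : ℝ) ^ α := Real.one_le_rpow hn₁ hα₀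
  obtain ⟨k, hk⟩ : ∃ k, k = ⌈(n : ℝ) ^ α⌉₊ + 4 := ⟨_, rfl⟩
  have hk4 : 4 ≤ k := by omega
  have hkα : (n : ℝ) ^ α ≤ k := by
    rw [hk]; push_cast
    linarith [Nat.le_ceil ((n : ℝ) ^ α)]
  have hkα' : (k : ℝ) ≤ 6 * (n : ℝ) ^ α := by
    rw [hk]; push_cast
    linarith [Nat.ceil_lt_add_one (show 0 ≤ (n : ℝ) ^ α by positivity)]
  have hkn : 4 * (k * k) ≤ n := by
    have h1 : (n : ℝ) ^ α * (n : ℝ) ^ α * (n : ℝ) ^ (1 - 2 * α) = n := by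
      rw [← Real.rpow_add hn₀, ← Real.rpow_add hn₀]
      convert Real.rpow_one (n : ℝ) using 2
      ring
    have h2 : 4 * ((k : ℝ) * k) ≤ n := by
      calc 4 * ((k : ℝ) * k) ≤ 4 * ((6 * (n : ℝ) ^ α) * (6 * (n : ℝ) ^ α)) := by gcongr
        _ = (n : ℝ) ^ α * (n : ℝ) ^ α * 144 := by ring
        _ ≤ (n : ℝ) ^ α * (n : ℝ) ^ α * (n : ℝ) ^ (1 - 2 * α) := by gcongr
        _ = n := h1
    exact_mod_cast h2
  have hkk : 4 * k ≤ k * k := Nat.mul_le_mul_right k hk4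
  -- The `2 * k` trails share the cells outside the square equally. The remainder prolongs the first
  -- row, which makes the number of vertices exactly `n`.
  obtain ⟨T, hTdef⟩ : ∃ T, T = (n - k * k) / (2 * k) := ⟨_, rfl⟩
  have hT₁ : 2 * k * T ≤ n - k * k := by rw [hTdef]; exact Nat.mul_div_le _ _
  have hT₂ : n - k * k < 2 * k * (T + 1) := by
    rw [hTdef]; exact Nat.lt_mul_div_succ _ (by omega)
  have hkT : n ≤ 8 * (k * T) := by
    have h1 : 2 * k * (T + 1) = 2 * (k * T) + 2 * k := by ring
    omega
  have hTk : T + k ≤ n := by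
    have h1 : 1 * T ≤ 2 * k * T := Nat.mul_le_mul_right T (by omega)
    omega
  obtain ⟨P⟩ := CrossingGrid.Layout.exists_of_card (n := n) (k := k) (T := T)
    (r := n - k * k - 2 * k * T) (by omega) (by
      have h1 : (T + k) * k + k * T = k * k + 2 * k * T := by ring
      omega)
  have hLk : 16 * ((K + 1) * L n) ≤ k := by
    rw [Real.norm_of_nonneg (by positivity), Real.norm_of_nonneg (by positivity), one_div,
      inv_mul_eq_div, le_div_iff₀ (by positivity)] at hL
    have h1 : (16 * ((K + 1) * L n) : ℝ) ≤ k := by linarith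
    exact_mod_cast h1
  have hCK : C n + 1 ≤ n ^ (K + 1) := by
    have h1 : 1 ≤ n ^ K := Nat.one_le_pow _ _ (by omega)
    have h2 : n ^ K * 2 ≤ n ^ K * n := Nat.mul_le_mul_left _ (by omega)
    rw [pow_succ]
    omega
  obtain ⟨G, hG, hS⟩ := P.exists_grid_scanned H M hTk (by omega) hC hH
    (labels_too_short hn hk4 (by omega) hCK hLk)
  refine ⟨G, hG, fun S h => ?_⟩
  have h1 : (T : ℝ) * (T * T * (k * k)) ≤ 2 * ∑ s, ∑ t, ((S s t).card : ℝ) := by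
    exact_mod_cast hS S h
  have h2 : (n : ℝ) ≤ 8 * (k * T) := by exact_mod_cast hkT
  have h3 : (n : ℝ) ^ (1 - α) ≤ 48 * T := by
    rw [Real.rpow_sub hn₀, Real.rpow_one, div_le_iff₀ (by positivity)]
    calc (n : ℝ) ≤ 8 * (k * T) := h2
      _ ≤ 8 * (6 * (n : ℝ) ^ α * T) := by gcongr
      _ = 48 * T * (n : ℝ) ^ α := by ring
  rw [le_div_iff₀ (by positivity)]
  calc 1 / 6144 * (n : ℝ) ^ (1 - α) * (n : ℝ) ^ 2
      ≤ 1 / 6144 * (48 * T) * (8 * (k * T)) ^ 2 := by gcongr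
    _ = (T : ℝ) * (T * T * (k * k)) / 2 := by ring
    _ ≤ ∑ s, ∑ t, ((S s t).card : ℝ) := by linarith
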